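/- Let $Y$ be a locally compact Hausdorff space, and let $C_0(Y,\mathbb{R})$ be the real Banach space, with the supremum norm, of all real-valued continuous functions on $Y$ that vanish at infinity. Say that a real Banach space $B$ has the Mazur–Ulam property if every surjective isometry from the unit sphere of $B$ onto the unit sphere of any real Banach space $F$ extends to a surjective real-linear isometry from $B$ onto $F$. For a linear subspace $E$ of $C_0(Y,\mathbb{R})$, let $\mathrm{Ch}(E)$ denote its Choquet boundary, that is, the set of all $y\in Y$ such that the evaluation functional $\delta_y : E\to\mathbb{R}$, $f\mapsto f(y)$, is an extreme point of the closed unit ball of the dual space $E^*$. Let $E$ be a closed linear subspace of $C_0(Y,\mathbb{R})$ which separates the points of $Y$ (for all $y_1\neq y_2$ in $Y$ there is $e\in E$ with $e(y_1)\neq e(y_2)$) and which satisfies the following condition (r): for every $y\in \mathrm{Ch}(E)$, every neighborhood $V$ of $y$ and every $\varepsilon>0$ there is $u\in E$ such that $0\le u\le 1=u(y)$ on $Y$ and $0\le u\le\varepsilon$ on $Y\setminus V$. Then $E$ has the Mazur–Ulam property. In particular, $C_0(Y,\mathbb{R})$ has the Mazur–Ulam property. -/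

import Mathlib

set_option maxSynthPendingDepth 3

open scoped ZeroAtInfty

universe u v

/-- A real normed space `E` has the Mazur–Ulam property if every surjective isometry from the unit
sphere of `E` onto the unit sphere of any real Banach space `F` extends to a surjective
real-linear isometry from `E` onto `F`. -/
def MazurUlamProperty (E : Type u) [NormedAddCommGroup E] [NormedSpace ℝ E] : Prop :=
  ∀ (F : Type v) [NormedAddCommGroup F] [NormedSpace ℝ F] [CompleteSpace F]
    (T : Metric.sphere (0 : E) 1 → Metric.sphere (0 : F) 1),
    Isometry T → Function.Surjective T →
      ∃ L : E ≃ₗᵢ[ℝ] F, ∀ a : Metric.sphere (0 : E) 1, L (a : E) = (T a : F)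

namespace C0Subspace

variable {Y : Type*} [TopologicalSpace Y]

/-- `E` separates the points of `Y`. -/
def SeparatesPoints (E : Submodule ℝ C₀(Y, ℝ)) : Prop :=
  ((fun f : C₀(Y, ℝ) => (f : Y → ℝ)) '' (E : Set C₀(Y, ℝ))).SeparatesPoints

/-- The evaluation functional `f ↦ f y` on `E`, as an element of the Banach dual of `E`. -/
noncomputable def pointEval (E : Submodule ℝ C₀(Y, ℝ)) (y : Y) : StrongDual ℝ E :=
  LinearMap.mkContinuous
    { toFun := fun f : E => (f : C₀(Y, ℝ)) y
      map_add' := fun _ _ => rfl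
      map_smul' := fun _ _ => rfl } 1
    (fun f => by
      rw [one_mul]
      exact (f : C₀(Y, ℝ)).toBCF.norm_coe_le_norm y)

@[simp]
theorem pointEval_apply (E : Submodule ℝ C₀(Y, ℝ)) (y : Y) (f : E) :
    pointEval E y f = (f : C₀(Y, ℝ)) y := rfl

/-- The Choquet boundary of `E`: the points `y` whose evaluation functional is an extreme point of
the closed unit ball of the dual of `E`. -/
def choquetBoundary (E : Submodule ℝ C₀(Y, ℝ)) : Set Y :=
  {y | pointEval E y ∈ (Metric.closedBall (0 : StrongDual ℝ E) 1).extremePoints ℝ}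

/-- Condition (r): for every `y` in the Choquet boundary of `E`, every neighborhood `V` of `y` and
every `ε > 0` there is `u ∈ E` with `0 ≤ u ≤ 1 = u y` on `Y` and `u ≤ ε` off `V`. -/
def ConditionR (E : Submodule ℝ C₀(Y, ℝ)) : Prop :=
  ∀ y ∈ choquetBoundary E, ∀ V ∈ nhds y, ∀ ε : ℝ, 0 < ε →
    ∃ u ∈ E, (∀ z, 0 ≤ u z ∧ u z ≤ 1) ∧ u y = 1 ∧ ∀ z ∉ V, u z ≤ ε

end C0Subspace

/-!
Let `T` be a surjective isometry from the unit sphere of `E` to that of `F`. It suffices to find,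
for each `y` in the Choquet boundary, a functional `ψ` on `F` with `ψ (T f) = f y` for all unit
vectors `f`. Each unit vector of `E` attains its norm at some point of the Choquet boundary, so
these functionals separate the points of `F`, and the positively homogeneous extension of `T` is
linear because composing it with each `ψ` gives a linear functional
(`mazurUlamProperty_of_functionals`).

The functional `ψ` is chosen equal to `1` on the image of the face `C = {g : ‖g‖ = 1, g y = 1}` and
to `-1` on the image of `-C`. It exists because the convex hull of `T(C) ∪ -T(-C)` stays in the unit
sphere (`exists_functional_on_image_convex`): given finitely many points of `C` with average `x`,
a maximal convex subset `M` of the sphere of `F` that contains `T x` and `-T(-x)` contains the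
corresponding images of all these points. Indeed `M` consists of the unit vectors `v` with
`‖v + m‖ = 2` for all `m ∈ M`, the equality `‖a - b‖ = 2` is preserved by `T`, and `‖x + z‖ = 2`
forces `‖x' + z‖ = 2` for each of the points `x'` averaged.

Since `ψ` and `T` are `1`-Lipschitz, `ψ (T f) ≥ 1 - dist(f, C)` and `ψ (T f) ≤ -1 + dist(f, -C)`.
Condition (r) gives `dist(f, C) ≤ 1 - f y`: the function `f`, slightly shrunk, is pushed up to the
value `1` at `y` by adding a series of peak functions concentrated closer and closer to `y`
(`C0Subspace.PeaksAt.exists_near_face`). Applied to `f` and to `-f`, this yields `ψ (T f) = f y`.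

That norms are attained on the Choquet boundary (`C0Subspace.exists_mem_choquetBoundary`) follows
from the Krein–Milman lemma, applied to the functionals of the dual ball equal to `1` at `f`, and
from Milman's converse, by which the extreme points of the dual ball are weak-* limits of functionals
`± f ↦ f y`.
-/

/-! ### Convex subsets of the unit sphere -/

section Sphere

variable {E : Type*} [NormedAddCommGroup E] [NormedSpace ℝ E]

theorem exists_functional_eq_one_of_norm_add_eq_two {a b : E} (ha : ‖a‖ = 1) (hb : ‖b‖ = 1)
    (hab : ‖a + b‖ = 2) : ∃ g : StrongDual ℝ E, (∀ v, g v ≤ ‖v‖) ∧ g a = 1 ∧ g b = 1 := by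
  obtain ⟨g, hg, hgab⟩ := exists_dual_vector'' ℝ (a + b)
  have hle : ∀ v, g v ≤ ‖v‖ := fun v =>
    (le_abs_self _).trans ((g.le_opNorm v).trans (mul_le_of_le_one_left (norm_nonneg v) hg))
  have h : g a + g b = 2 := by rw [← map_add, hgab, hab]; simp
  have h1 := hle a
  have h2 := hle b
  exact ⟨g, hle, by linarith, by linarith⟩

theorem norm_add_eq_two_of_mem_convex {M : Set E} (hM : Convex ℝ M)
    (hMs : M ⊆ Metric.sphere 0 1) {a b : E} (ha : a ∈ M) (hb : b ∈ M) : ‖a + b‖ = 2 := by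
  have h := hMs (hM ha hb (by norm_num : (0 : ℝ) ≤ 1 / 2) (by norm_num : (0 : ℝ) ≤ 1 / 2)
    (by norm_num))
  rw [mem_sphere_zero_iff_norm, ← smul_add, norm_smul] at h
  norm_num at h
  linarith

theorem segment_subset_sphere {a b : E} (ha : ‖a‖ = 1) (hb : ‖b‖ = 1)
    (hab : ‖a + b‖ = 2) : segment ℝ a b ⊆ Metric.sphere 0 1 := by
  obtain ⟨g, hg, hga, hgb⟩ := exists_functional_eq_one_of_norm_add_eq_two ha hb hab
  rintro _ ⟨s, t, hs, ht, hst, rfl⟩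
  rw [mem_sphere_zero_iff_norm]
  apply le_antisymm
  · calc ‖s • a + t • b‖ ≤ ‖s • a‖ + ‖t • b‖ := norm_add_le _ _
      _ = 1 := by rw [norm_smul, norm_smul, ha, hb, Real.norm_of_nonneg hs,
        Real.norm_of_nonneg ht, mul_one, mul_one, hst]
  · have h := hg (s • a + t • b)
    simpa [hga, hgb, hst] using h

/-- The maximal convex subsets of the unit sphere of `E`. -/
def IsMaximalSphereConvex (M : Set E) : Prop :=
  Maximal (fun s : Set E => Convex ℝ s ∧ s ⊆ Metric.sphere 0 1) M

theorem exists_isMaximalSphereConvex {C : Set E} (hC : Convex ℝ C)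
    (hCs : C ⊆ Metric.sphere 0 1) : ∃ M, C ⊆ M ∧ IsMaximalSphereConvex M := by
  refine zorn_subset_nonempty {s : Set E | Convex ℝ s ∧ s ⊆ Metric.sphere 0 1} ?_ C ⟨hC, hCs⟩
  intro c hc hchain _
  refine ⟨⋃₀ c, ⟨?_, ?_⟩, fun s hs => Set.subset_sUnion_of_mem hs⟩
  · exact hchain.directedOn.convex_sUnion fun s hs => (hc hs).1
  · exact Set.sUnion_subset fun s hs => (hc hs).2

/-- A maximal convex subset `M` of the sphere is its own polar for the relation `‖a + b‖ = 2`. -/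
theorem IsMaximalSphereConvex.mem_of_norm_add_eq_two {M : Set E} (hM : IsMaximalSphereConvex M)
    (hne : M.Nonempty) {y : E} (hy : ‖y‖ = 1) (h : ∀ m ∈ M, ‖y + m‖ = 2) : y ∈ M := by
  have hsub : convexHull ℝ (insert y M) ⊆ Metric.sphere 0 1 := by
    rw [convexHull_insert hne, hM.prop.1.convexHull_eq]
    intro z hz
    rw [mem_convexJoin] at hz
    obtain ⟨a, ha, m, hm, hz⟩ := hz
    rw [Set.mem_singleton_iff.1 ha] at hz
    exact segment_subset_sphere hy (mem_sphere_zero_iff_norm.1 (hM.prop.2 hm)) (h m hm) hz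
  have hle : M ⊆ convexHull ℝ (insert y M) :=
    (Set.subset_insert y M).trans (subset_convexHull ℝ _)
  exact hM.le_of_ge ⟨convex_convexHull ℝ _, hsub⟩ hle
    (subset_convexHull ℝ _ (Set.mem_insert y M))

/-- If `‖x + z‖ = 2`, that is, if the unit vector `z` lies in a common face of the unit ball with `x`,
and `x` is an average of unit vectors, then `z` has the same relation to each of these vectors. -/
theorem norm_add_eq_two_of_average {ι : Type*} [Fintype ι] {a : ι → E} (ha : ∀ i, ‖a i‖ = 1)
    {w : ι → ℝ} (hw : ∀ i, 0 < w i) (hw1 : ∑ i, w i = 1) {z : E} (hz : ‖z‖ = 1)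
    (hx : ‖∑ i, w i • a i‖ = 1) (h : ‖(∑ i, w i • a i) + z‖ = 2) (i : ι) : ‖a i + z‖ = 2 := by
  obtain ⟨g, hg, hga, hgz⟩ := exists_functional_eq_one_of_norm_add_eq_two hx hz h
  have hle : ∀ j ∈ Finset.univ, w j * g (a j) ≤ w j := fun j _ =>
    mul_le_of_le_one_right (hw j).le ((hg _).trans (ha j).le)
  have hsum : ∑ j, w j * g (a j) = ∑ j, w j := by simpa [hw1] using hga
  have hi := (Finset.sum_eq_sum_iff_of_le hle).1 hsum i (Finset.mem_univ i)
  have hgi : g (a i) = 1 := by simpa [(hw i).ne'] using hi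
  apply le_antisymm
  · calc ‖a i + z‖ ≤ ‖a i‖ + ‖z‖ := norm_add_le _ _
      _ = 2 := by rw [ha, hz]; norm_num
  · have := hg (a i + z)
    rw [map_add, hgi, hgz] at this
    linarith

/-- A convex subset of the unit sphere lies in a hyperplane supporting the unit ball. -/
theorem exists_functional_eq_one_on_convex {K : Set E} (hK : Convex ℝ K)
    (hKs : K ⊆ Metric.sphere 0 1) :
    ∃ g : StrongDual ℝ E, (∀ v, g v ≤ ‖v‖) ∧ ∀ k ∈ K, g k = 1 := by
  rcases K.eq_empty_or_nonempty with rfl | hne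
  · exact ⟨0, fun v => by simp, by simp⟩
  have hdisj : Disjoint (Metric.ball (0 : E) 1) K :=
    Metric.sphere_disjoint_ball.symm.mono_right hKs
  obtain ⟨f, c, hf, hfK⟩ := geometric_hahn_banach_open (convex_ball (0 : E) 1) Metric.isOpen_ball
    hK hdisj
  have hc : 0 < c := by simpa using hf 0 (by simp)
  have hle : ∀ v, (c⁻¹ • f) v ≤ ‖v‖ := by
    intro v
    refine le_of_forall_gt_imp_ge_of_dense fun r hr => ?_
    have hr0 : 0 < r := (norm_nonneg v).trans_lt hr
    have h := hf (r⁻¹ • v) (by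
      rw [mem_ball_zero_iff, norm_smul, norm_inv, Real.norm_of_nonneg hr0.le,
        inv_mul_lt_iff₀ hr0, mul_one]
      exact hr)
    rw [map_smul, smul_eq_mul, inv_mul_lt_iff₀ hr0] at h
    simp only [smul_apply, smul_eq_mul]
    rw [inv_mul_le_iff₀ hc]
    linarith
  refine ⟨c⁻¹ • f, hle, fun k hk => le_antisymm ?_ ?_⟩
  · exact (hle k).trans (mem_sphere_zero_iff_norm.1 (hKs hk)).le
  · simp only [smul_apply, smul_eq_mul]
    rw [le_inv_mul_iff₀ hc, mul_one]
    exact hfK k hk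

end Sphere

/-! ### Surjective isometries between unit spheres -/

theorem norm_sub_of_sphere_isometry {E F : Type*} [NormedAddCommGroup E] [NormedAddCommGroup F]
    {T : Metric.sphere (0 : E) 1 → Metric.sphere (0 : F) 1} (hT : Isometry T)
    (a b : Metric.sphere (0 : E) 1) : ‖(T a : F) - T b‖ = ‖(a : E) - b‖ := by
  rw [← dist_eq_norm, ← dist_eq_norm, ← Subtype.dist_eq, ← Subtype.dist_eq, hT.dist_eq]

/-- If `‖x + z‖ = 2` implies `‖y + z‖ = 2` for all unit vectors `z`, then a maximal convex set
containing `T x` and `-T (-x)` contains `T y` and `-T (-y)`. Such a set is its own polar for the relation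
`‖a + b‖ = 2`, and that relation is preserved by `T` up to the sign of one of the two points. -/
theorem map_mem_of_star_subset {E F : Type*} [NormedAddCommGroup E] [NormedAddCommGroup F]
    [NormedSpace ℝ F] {T : Metric.sphere (0 : E) 1 → Metric.sphere (0 : F) 1}
    (hT : Isometry T) (hs : Function.Surjective T)
    {x y : Metric.sphere (0 : E) 1}
    (hxy : ∀ z : E, ‖z‖ = 1 → ‖(x : E) + z‖ = 2 → ‖(y : E) + z‖ = 2)
    {M : Set F} (hM : IsMaximalSphereConvex M) (h1 : (T x : F) ∈ M) (h2 : -(T (-x) : F) ∈ M) :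
    (T y : F) ∈ M ∧ -(T (-y) : F) ∈ M := by
  have hnorm := norm_sub_of_sphere_isometry hT
  constructor
  · refine hM.mem_of_norm_add_eq_two ⟨_, h1⟩ (norm_eq_of_mem_sphere _) fun m hm => ?_
    obtain ⟨z, hz⟩ := hs (-⟨m, hM.prop.2 hm⟩)
    have hz' : m = -(T z : F) := by rw [hz]; simp
    have h3 := norm_add_eq_two_of_mem_convex hM.prop.1 hM.prop.2 h1 hm
    rw [hz', ← sub_eq_add_neg, hnorm, sub_eq_add_neg] at h3 ⊢
    exact hxy _ (by simp) h3
  · refine hM.mem_of_norm_add_eq_two ⟨_, h1⟩ (by simp) fun m hm => ?_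
    obtain ⟨z, hz⟩ := hs ⟨m, hM.prop.2 hm⟩
    have hz' : m = (T z : F) := by rw [hz]
    have h3 := norm_add_eq_two_of_mem_convex hM.prop.1 hM.prop.2 h2 hm
    have key : ∀ w : Metric.sphere (0 : E) 1, ‖-(T (-w) : F) + m‖ = ‖(w : E) + z‖ := by
      intro w
      rw [hz', neg_add_eq_sub, hnorm, coe_neg_sphere, sub_neg_eq_add, add_comm]
    rw [key] at h3 ⊢
    exact hxy _ (by simp) h3

section SphereIsometry

variable {E : Type*} [NormedAddCommGroup E] [NormedSpace ℝ E]
  {F : Type*} [NormedAddCommGroup F] [NormedSpace ℝ F]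
  {T : Metric.sphere (0 : E) 1 → Metric.sphere (0 : F) 1}

/-- For a convex subset `C` of the sphere, the convex hull of `T(C) ∪ -T(-C)` stays in the
sphere: finitely many points of `C` are controlled by their average. Separating that hull from the
open unit ball gives the functional. -/
theorem exists_functional_on_image_convex (hT : Isometry T) (hs : Function.Surjective T)
    {C : Set E} (hC : Convex ℝ C) (hCs : C ⊆ Metric.sphere 0 1) :
    ∃ g : StrongDual ℝ F, (∀ v, g v ≤ ‖v‖) ∧
      ∀ x : Metric.sphere (0 : E) 1, (x : E) ∈ C → g (T x) = 1 ∧ g (T (-x)) = -1 := by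
  set D : Set F := {v | ∃ x : Metric.sphere (0 : E) 1, (x : E) ∈ C ∧
    (v = T x ∨ v = -(T (-x) : F))} with hD
  have hDs : convexHull ℝ D ⊆ Metric.sphere 0 1 := by
    intro k hk
    obtain ⟨ι, _, w, a, hw0, hw1, ha, rfl⟩ := mem_convexHull_iff_exists_fintype.1 hk
    choose x hxC hxa using ha
    have hne : Nonempty ι := by
      by_contra h
      rw [not_nonempty_iff] at h
      simp at hw1
    have hcard : 0 < (Fintype.card ι : ℝ) := by exact_mod_cast Fintype.card_pos
    -- The uniform average is used, not `∑ i, w i • x i`, since some weights `w i` may vanish.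
    have hp1 : ∑ _i : ι, (Fintype.card ι : ℝ)⁻¹ = 1 := by
      simp [hcard.ne']
    have hpC : ∑ i, (Fintype.card ι : ℝ)⁻¹ • (x i : E) ∈ C :=
      hC.sum_mem (fun _ _ => inv_nonneg.2 hcard.le) hp1 fun i _ => hxC i
    set p : Metric.sphere (0 : E) 1 := ⟨_, hCs hpC⟩ with hp
    have hadd : ‖(T p : F) + -(T (-p) : F)‖ = 2 := by
      rw [← sub_eq_add_neg, norm_sub_of_sphere_isometry hT, coe_neg_sphere, sub_neg_eq_add,
        ← two_smul ℝ, norm_smul]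
      simp
    obtain ⟨M, hMsub, hM⟩ := exists_isMaximalSphereConvex (convex_segment (𝕜 := ℝ) _ _)
      (segment_subset_sphere (by simp) (by simp) hadd)
    have hmem : ∀ i, a i ∈ M := by
      intro i
      have h := map_mem_of_star_subset hT hs (x := p) (y := x i) (fun z hz hpz =>
        norm_add_eq_two_of_average (fun j => norm_eq_of_mem_sphere (x j))
          (fun _ => inv_pos.2 hcard) hp1 hz (norm_eq_of_mem_sphere p) hpz i) hM
        (hMsub (left_mem_segment ℝ _ _)) (hMsub (right_mem_segment ℝ _ _))
      rcases hxa i with h' | h' <;> rw [h']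
      exacts [h.1, h.2]
    exact hM.prop.2 (hM.prop.1.sum_mem (fun i _ => hw0 i) hw1 fun i _ => hmem i)
  obtain ⟨g, hg, hgD⟩ := exists_functional_eq_one_on_convex (convex_convexHull ℝ D) hDs
  refine ⟨g, hg, fun x hx => ⟨hgD _ (subset_convexHull ℝ _ ⟨x, hx, Or.inl rfl⟩), ?_⟩⟩
  have h := hgD _ (subset_convexHull ℝ _ ⟨x, hx, Or.inr rfl⟩)
  rw [map_neg] at h
  linarith

/-- If the distance from each point `f` of the sphere to the face `{δ = 1}` is at most `1 - δ f`,
then `δ` is transported by `T` to a functional on `F`: the Lipschitz bounds coming from the faces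
`{δ = 1}` and `{δ = -1}` squeeze the value of the functional at `T f`. -/
theorem exists_functional_comp_eq (hT : Isometry T) (hs : Function.Surjective T)
    {δ : StrongDual ℝ E} (hδ : ∀ f, δ f ≤ ‖f‖)
    (hface : ∀ f : E, ‖f‖ = 1 → ∀ ε : ℝ, 0 < ε →
      ∃ g : E, ‖g‖ = 1 ∧ δ g = 1 ∧ ‖g - f‖ ≤ 1 - δ f + ε) :
    ∃ ψ : StrongDual ℝ F, ∀ f : Metric.sphere (0 : E) 1, ψ (T f) = δ f := by
  set C : Set E := {g | ‖g‖ ≤ 1 ∧ δ g = 1} with hCdef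
  have hC : Convex ℝ C := by
    have h1 : Convex ℝ (Metric.closedBall (0 : E) 1) := convex_closedBall _ _
    have h2 : Convex ℝ {g | δ g = 1} := convex_hyperplane (f := δ) δ.toLinearMap.isLinear 1
    convert h1.inter h2 using 1
    ext g
    simp [hCdef]
  have hCs : C ⊆ Metric.sphere 0 1 := fun g hg =>
    mem_sphere_zero_iff_norm.2 (le_antisymm hg.1 (hg.2 ▸ hδ g))
  obtain ⟨ψ, hψ, hψC⟩ := exists_functional_on_image_convex hT hs hC hCs
  refine ⟨ψ, fun f => le_antisymm ?_ ?_⟩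
  · refine le_of_forall_pos_le_add fun ε hε => ?_
    obtain ⟨g, hg1, hg2, hg⟩ := hface (-f) (by simp) ε hε
    have hgs : g ∈ Metric.sphere (0 : E) 1 := mem_sphere_zero_iff_norm.2 hg1
    have h1 := (hψC ⟨g, hgs⟩ ⟨hg1.le, hg2⟩).2
    have h2 := hψ (T f - T (-⟨g, hgs⟩))
    rw [norm_sub_of_sphere_isometry hT, map_sub, h1, coe_neg_sphere, sub_neg_eq_add,
      sub_neg_eq_add] at h2
    rw [map_neg, sub_neg_eq_add, add_comm g] at hg
    dsimp only at h2
    linarith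
  · refine le_of_forall_pos_le_add fun ε hε => ?_
    obtain ⟨g, hg1, hg2, hg⟩ := hface f (by simp) ε hε
    have hgs : g ∈ Metric.sphere (0 : E) 1 := mem_sphere_zero_iff_norm.2 hg1
    have h1 := (hψC ⟨g, hgs⟩ ⟨hg1.le, hg2⟩).1
    have h2 := hψ (T ⟨g, hgs⟩ - T f)
    rw [norm_sub_of_sphere_isometry hT, map_sub, h1] at h2
    dsimp only at h2
    linarith

end SphereIsometry

/-- A space `E` has the Mazur–Ulam property as soon as it has a family `Δ` of functionals in the
dual unit ball at which every unit vector attains its norm, and for which the distance from a unit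
vector `f` to the face `{δ = 1}` is at most `1 - δ f`. -/
theorem mazurUlamProperty_of_functionals {E : Type u} [NormedAddCommGroup E] [NormedSpace ℝ E]
    (Δ : Set (StrongDual ℝ E)) (hΔ : ∀ δ ∈ Δ, ∀ f, δ f ≤ ‖f‖)
    (hnorm : ∀ f : E, ‖f‖ = 1 → ∃ δ ∈ Δ, |δ f| = 1)
    (hface : ∀ δ ∈ Δ, ∀ f : E, ‖f‖ = 1 → ∀ ε : ℝ, 0 < ε →
      ∃ g : E, ‖g‖ = 1 ∧ δ g = 1 ∧ ‖g - f‖ ≤ 1 - δ f + ε) :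
    MazurUlamProperty.{u, v} E := by
  intro F _ _ _ T hT hs
  have key : ∀ δ : Δ, ∃ ψ : StrongDual ℝ F, ∀ f : Metric.sphere (0 : E) 1, ψ (T f) = δ.1 f :=
    fun δ => exists_functional_comp_eq hT hs (hΔ δ.1 δ.2) (hface δ.1 δ.2)
  choose ψ hψ using key
  -- The transported functionals separate the points of `F`.
  have hsep : ∀ w : F, (∀ δ, ψ δ w = 0) → w = 0 := by
    intro w hw
    by_contra hw0
    have hn : ‖w‖ ≠ 0 := norm_ne_zero_iff.2 hw0
    obtain ⟨f, hf⟩ := hs ⟨‖w‖⁻¹ • w, by simp [norm_smul, hn]⟩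
    obtain ⟨δ, hδ, hδf⟩ := hnorm f (by simp)
    have h := hψ ⟨δ, hδ⟩ f
    rw [hf] at h
    simp only [map_smul, hw, smul_zero] at h
    rw [← h] at hδf
    simp at hδf
  have huniq : ∀ w w' : F, (∀ δ, ψ δ w = ψ δ w') → w = w' := fun w w' h =>
    sub_eq_zero.1 (hsep _ fun δ => by rw [map_sub, h, sub_self])
  have hex : ∀ f : E, ∃ w : F, ‖w‖ = ‖f‖ ∧ ∀ δ : Δ, ψ δ w = δ.1 f := by
    intro f
    by_cases hf : f = 0
    · exact ⟨0, by simp [hf], fun δ => by simp [hf]⟩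
    have hn : ‖f‖ ≠ 0 := norm_ne_zero_iff.2 hf
    refine ⟨‖f‖ • (T ⟨‖f‖⁻¹ • f, by simp [norm_smul, hn]⟩ : F), by simp [norm_smul], fun δ => ?_⟩
    rw [map_smul, hψ, map_smul, smul_smul, mul_inv_cancel₀ hn, one_smul]
  choose L hLn hLψ using hex
  let L' : E →ₗᵢ[ℝ] F :=
    { toFun := L
      map_add' := fun f g => huniq _ _ fun δ => by simp only [map_add, hLψ]
      map_smul' := fun c f => huniq _ _ fun δ => by simp only [map_smul, hLψ, RingHom.id_apply]
      norm_map' := hLn }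
  have hLT : ∀ a : Metric.sphere (0 : E) 1, L a = T a := fun a =>
    huniq _ _ fun δ => by rw [hLψ, hψ]
  have hsurj : Function.Surjective L' := by
    intro w
    by_cases hw : w = 0
    · exact ⟨0, by simp [hw]⟩
    have hn : ‖w‖ ≠ 0 := norm_ne_zero_iff.2 hw
    obtain ⟨f, hf⟩ := hs ⟨‖w‖⁻¹ • w, by simp [norm_smul, hn]⟩
    refine ⟨‖w‖ • (f : E), ?_⟩
    rw [map_smul]
    change ‖w‖ • L f = w
    rw [hLT, hf, smul_smul, mul_inv_cancel₀ hn, one_smul]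
  exact ⟨LinearIsometryEquiv.ofSurjective L' hsurj, hLT⟩

/-! ### Peak functions -/

namespace C0Subspace

open Filter Topology

variable {Y : Type*} [TopologicalSpace Y]

theorem abs_apply_le_norm (f : C₀(Y, ℝ)) (z : Y) : |f z| ≤ ‖f‖ :=
  f.toBCF.norm_coe_le_norm z

theorem norm_le_of_forall {f : C₀(Y, ℝ)} {c : ℝ} (hc : 0 ≤ c) (h : ∀ z, |f z| ≤ c) : ‖f‖ ≤ c :=
  (BoundedContinuousFunction.norm_le (f := f.toBCF) hc).2 h

theorem continuous_apply_point (z : Y) : Continuous fun f : C₀(Y, ℝ) => f z := by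
  refine (LipschitzWith.of_dist_le_mul (K := 1) fun f g => ?_).continuous
  rw [NNReal.coe_one, one_mul, dist_eq_norm, dist_eq_norm]
  exact abs_apply_le_norm (f - g) z

/-- The point `y` has approximate peak functions in `E`; condition (r) asks for this at the points
of the Choquet boundary. -/
def PeaksAt (E : Submodule ℝ C₀(Y, ℝ)) (y : Y) : Prop :=
  ∀ V ∈ 𝓝 y, ∀ ε : ℝ, 0 < ε →
    ∃ u ∈ E, (∀ z, 0 ≤ u z ∧ u z ≤ 1) ∧ u y = 1 ∧ ∀ z ∉ V, u z ≤ ε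

/-- Adding a peak function halves the gap `R` between `h y` and `1`. The peak function is taken so
concentrated that the gap between `h` and `1` over the whole space is at most halved too. -/
theorem PeaksAt.exists_halve_gap {E : Submodule ℝ C₀(Y, ℝ)} {y : Y} (hy : PeaksAt E y)
    {h : C₀(Y, ℝ)} (hE : h ∈ E) {R α : ℝ} (hR : 0 < R) (hα : 0 < α) (hα' : α ≤ 1 / 2)
    (hhy : h y = 1 - R) (hh : ∀ z, h z ≤ 1 - α * R) :
    ∃ k ∈ E, (∀ z, h z ≤ k z ∧ k z ≤ h z + R / 2) ∧ k y = 1 - R / 2 ∧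
      ∀ z, k z ≤ 1 - α * (R / 2) := by
  have hV : {z | h z < h y + R / 4} ∈ 𝓝 y :=
    (isOpen_lt (map_continuous h) continuous_const).mem_nhds (by simp [hR])
  obtain ⟨u, huE, hu, huy, huV⟩ := hy _ hV α hα
  refine ⟨h + (R / 2) • u, E.add_mem hE (E.smul_mem _ huE), fun z => ?_, ?_, fun z => ?_⟩
  · simp only [ZeroAtInftyContinuousMap.add_apply, ZeroAtInftyContinuousMap.smul_apply,
      smul_eq_mul]
    have h1 := mul_nonneg hR.le (hu z).1
    have h2 := mul_le_mul_of_nonneg_left (hu z).2 hR.le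
    constructor <;> linarith
  · simp only [ZeroAtInftyContinuousMap.add_apply, ZeroAtInftyContinuousMap.smul_apply,
      smul_eq_mul, huy, hhy]
    ring
  · simp only [ZeroAtInftyContinuousMap.add_apply, ZeroAtInftyContinuousMap.smul_apply,
      smul_eq_mul]
    by_cases hz : z ∈ {z | h z < h y + R / 4}
    · have h1 : h z < h y + R / 4 := hz
      have h2 := mul_le_mul_of_nonneg_left (hu z).2 hR.le
      have h3 := mul_le_mul_of_nonneg_right hα' hR.le
      linarith
    · have h1 := mul_le_mul_of_nonneg_left (huV z hz) hR.le
      have h2 := hh z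
      linarith

/-- The distance from a function `f` of the unit ball to the face `{g y = 1}` of the unit ball is
at most `1 - f y`. -/
theorem PeaksAt.exists_near_face {E : Submodule ℝ C₀(Y, ℝ)} (hcl : IsClosed (E : Set C₀(Y, ℝ)))
    {y : Y} (hy : PeaksAt E y) {f : C₀(Y, ℝ)} (hfE : f ∈ E) (hf : ‖f‖ ≤ 1) {ε : ℝ} (hε : 0 < ε) :
    ∃ g ∈ E, ‖g‖ = 1 ∧ g y = 1 ∧ ‖g - f‖ ≤ 1 - f y + ε := by
  have hfz : ∀ z, -1 ≤ f z ∧ f z ≤ 1 := fun z =>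
    abs_le.1 ((abs_apply_le_norm f z).trans hf)
  -- Shrinking `f` by the factor `1 - r` leaves the room needed to add peak functions.
  obtain ⟨r, hr0, hr1, hrε⟩ : ∃ r : ℝ, 0 < r ∧ r ≤ 1 ∧ 2 * r ≤ ε :=
    ⟨min 1 (ε / 2), by positivity, min_le_left _ _, by linarith [min_le_right 1 (ε / 2)]⟩
  have hmul : ∀ z, -(1 - r) ≤ (1 - r) * f z ∧ (1 - r) * f z ≤ 1 - r := fun z =>
    ⟨by nlinarith [hfz z], by nlinarith [hfz z]⟩
  set R : ℝ := 1 - (1 - r) * f y with hRdef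
  have hR : 0 < R := by linarith [hmul y]
  have hR2 : R ≤ 2 := by linarith [hmul y]
  have hRr : r / 2 * R ≤ r := by nlinarith
  -- The `n`-th approximation has gap `R / 2 ^ n` at `y`; starting the step lemma requires
  -- `α * R ≤ r`, which `α = r / 2` ensures because `R ≤ 2`.
  let P : ℕ → C₀(Y, ℝ) → Prop := fun n h =>
    h ∈ E ∧ h y = 1 - R / 2 ^ n ∧ ∀ z, -1 ≤ h z ∧ h z ≤ 1 - r / 2 * (R / 2 ^ n)
  have hstep : ∀ n (h : {h // P n h}), ∃ k : {k // P (n + 1) k},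
      ∀ z, h.1 z ≤ k.1 z ∧ k.1 z ≤ h.1 z + R / 2 ^ n / 2 := by
    rintro n ⟨h, hE, hhy, hh⟩
    obtain ⟨k, hk, hk1, hk2, hk3⟩ := hy.exists_halve_gap hE (by positivity) (half_pos hr0)
      (by linarith) hhy fun z => (hh z).2
    refine ⟨⟨k, hk, ?_, fun z => ⟨(hh z).1.trans (hk1 z).1, ?_⟩⟩, hk1⟩
    · rw [hk2, pow_succ, div_div]
    · rw [pow_succ, ← div_div]
      exact hk3 z
  choose next hnext using hstep
  let s : ∀ n, {h // P n h} := fun n => Nat.rec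
    ⟨(1 - r) • f, E.smul_mem _ hfE, by simp [hRdef], fun z => by
      simp only [ZeroAtInftyContinuousMap.smul_apply, smul_eq_mul, pow_zero, div_one]
      constructor <;> linarith [hmul z]⟩ (fun n h => next n h) n
  have hs : ∀ n, dist (s n).1 (s (n + 1)).1 ≤ R / 2 / 2 ^ n := by
    intro n
    rw [dist_comm, dist_eq_norm, div_right_comm]
    refine norm_le_of_forall (by positivity) fun z => ?_
    have h := hnext n (s n) z
    rw [ZeroAtInftyContinuousMap.sub_apply, abs_of_nonneg (sub_nonneg.2 h.1)]
    linarith [h.2]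
  obtain ⟨g, hg⟩ := cauchySeq_tendsto_of_complete (cauchySeq_of_le_geometric_two hs)
  have hgE : g ∈ E := hcl.mem_of_tendsto hg (Eventually.of_forall fun n => (s n).2.1)
  have hev : ∀ z, Tendsto (fun n => (s n).1 z) atTop (𝓝 (g z)) := fun z =>
    ((continuous_apply_point z).tendsto g).comp hg
  have hgy : g y = 1 := by
    refine tendsto_nhds_unique (hev y) ?_
    have h0 : Tendsto (fun n : ℕ => R * (1 / 2 : ℝ) ^ n) atTop (𝓝 (R * 0)) :=
      (tendsto_pow_atTop_nhds_zero_of_lt_one (by norm_num) (by norm_num)).const_mul R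
    have h1 := h0.const_sub 1
    rw [mul_zero, sub_zero] at h1
    refine h1.congr fun n => ?_
    rw [(s n).2.2.1, one_div, inv_pow, div_eq_mul_inv]
  have hgle : ‖g‖ ≤ 1 := norm_le_of_forall zero_le_one fun z =>
    abs_le.2 ⟨ge_of_tendsto' (hev z) fun n => ((s n).2.2.2 z).1,
      le_of_tendsto' (hev z) fun n => ((s n).2.2.2 z).2.trans (by
        have : 0 ≤ r / 2 * (R / 2 ^ n) := by positivity
        linarith)⟩
  refine ⟨g, hgE, le_antisymm hgle ?_, hgy, ?_⟩
  · have := abs_apply_le_norm g y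
    rwa [hgy, abs_one] at this
  · have h1 : ‖g - (1 - r) • f‖ ≤ R := by
      rw [← dist_eq_norm, dist_comm]
      exact dist_le_of_le_geometric_two_of_tendsto₀ hs hg
    have h2 : ‖(1 - r) • f - f‖ ≤ r := by
      have : (1 - r) • f - f = (-r) • f := by module
      rw [this, norm_smul, norm_neg, Real.norm_of_nonneg hr0.le]
      exact mul_le_of_le_one_right hr0.le hf
    have h3 := norm_sub_le_norm_sub_add_norm_sub g ((1 - r) • f) f
    have h4 : r * f y ≤ r := mul_le_of_le_one_right hr0.le (hfz y).2
    have h5 : R = 1 - f y + r * f y := by rw [hRdef]; ring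
    linarith

end C0Subspace

/-! ### Extreme points of the dual unit ball -/

section Milman

variable {X : Type*} [AddCommGroup X] [Module ℝ X] [TopologicalSpace X]

theorem isCompact_convexJoin [ContinuousAdd X] [ContinuousSMul ℝ X] {s t : Set X}
    (hs : IsCompact s) (ht : IsCompact t) : IsCompact (convexJoin ℝ s t) := by
  have h : convexJoin ℝ s t = (fun p : (X × X) × ℝ => (1 - p.2) • p.1.1 + p.2 • p.1.2) ''
      ((s ×ˢ t) ×ˢ Set.Icc 0 1) := by
    ext z
    simp only [mem_convexJoin, segment_eq_image, Set.mem_image, Set.mem_prod, Prod.exists]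
    constructor
    · rintro ⟨a, ha, b, hb, θ, hθ, rfl⟩
      exact ⟨a, b, θ, ⟨⟨ha, hb⟩, hθ⟩, rfl⟩
    · rintro ⟨a, b, θ, ⟨⟨ha, hb⟩, hθ⟩, rfl⟩
      exact ⟨a, ha, b, hb, θ, hθ, rfl⟩
  rw [h]
  exact ((hs.prod ht).prod isCompact_Icc).image (by fun_prop)

variable [IsTopologicalAddGroup X] [ContinuousSMul ℝ X] [T2Space X]

/-- An extreme point of a compact set `K` that avoids the closed convex hulls of `s` and `t` also
avoids that of `s ∪ t`. -/
theorem notMem_closedConvexHull_union {K s t : Set X} (hK : IsCompact K) (hKc : Convex ℝ K)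
    {x : X} (hx : x ∈ K.extremePoints ℝ) (hs : s ⊆ K) (ht : t ⊆ K)
    (hxs : x ∉ closedConvexHull ℝ s) (hxt : x ∉ closedConvexHull ℝ t) :
    x ∉ closedConvexHull ℝ (s ∪ t) := by
  rcases s.eq_empty_or_nonempty with rfl | ⟨a, ha⟩
  · simpa using hxt
  rcases t.eq_empty_or_nonempty with rfl | ⟨b, hb⟩
  · simpa using hxs
  have hsK : closedConvexHull ℝ s ⊆ K := closedConvexHull_min hs hKc hK.isClosed
  have htK : closedConvexHull ℝ t ⊆ K := closedConvexHull_min ht hKc hK.isClosed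
  have hsc : IsCompact (closedConvexHull ℝ s) := hK.of_isClosed_subset isClosed_closedConvexHull hsK
  have htc : IsCompact (closedConvexHull ℝ t) := hK.of_isClosed_subset isClosed_closedConvexHull htK
  have hsub : closedConvexHull ℝ (s ∪ t) ⊆
      convexJoin ℝ (closedConvexHull ℝ s) (closedConvexHull ℝ t) := by
    refine closedConvexHull_min (Set.union_subset ?_ ?_) ?_ ?_
    · exact subset_closedConvexHull.trans
        (subset_convexJoin_left ⟨b, subset_closedConvexHull hb⟩)
    · exact subset_closedConvexHull.trans
        (subset_convexJoin_right ⟨a, subset_closedConvexHull ha⟩)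
    · exact (convex_closedConvexHull).convexJoin (convex_closedConvexHull)
    · exact (isCompact_convexJoin hsc htc).isClosed
  intro h
  obtain ⟨p, hp, q, hq, hpq⟩ := mem_convexJoin.1 (hsub h)
  rcases (mem_extremePoints_iff_forall_segment.1 hx).2 p (hsK hp) q (htK hq) hpq with rfl | rfl
  exacts [hxs hp, hxt hq]

/-- Milman's converse to the Krein–Milman theorem. -/
theorem mem_closure_of_mem_extremePoints_closedConvexHull [LocallyConvexSpace ℝ X] {A : Set X}
    (hK : IsCompact (closedConvexHull ℝ A)) {x : X}
    (hx : x ∈ (closedConvexHull ℝ A).extremePoints ℝ) : x ∈ closure A := by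
  by_contra hxA
  have hcl : closure A ⊆ closedConvexHull ℝ A :=
    closure_minimal subset_closedConvexHull isClosed_closedConvexHull
  have hAc : IsCompact (closure A) := hK.of_isClosed_subset isClosed_closure hcl
  have key : x ∉ closedConvexHull ℝ (closure A ∩ closure A) := by
    refine hAc.induction_on (p := fun S => x ∉ closedConvexHull ℝ (S ∩ closure A)) ?_ ?_ ?_ ?_
    · simp [closedConvexHull_eq_closure_convexHull]
    · intro s t hst ht h
      exact ht ((closedConvexHull ℝ).monotone (Set.inter_subset_inter_left _ hst) h)
    · intro s t hs ht
      rw [Set.union_inter_distrib_right]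
      exact notMem_closedConvexHull_union hK convex_closedConvexHull hx
        (Set.inter_subset_right.trans hcl) (Set.inter_subset_right.trans hcl) hs ht
    · intro a ha
      have hax : a ≠ x := fun h => hxA (h ▸ ha)
      obtain ⟨f, hf⟩ := geometric_hahn_banach_point_point hax
      obtain ⟨c, hac, hcx⟩ := exists_between hf
      -- The half-space `{f ≤ c}` is a closed convex neighbourhood of `a` that misses `x`.
      refine ⟨{z | f z ≤ c}, mem_nhdsWithin_of_mem_nhds ?_, fun h => ?_⟩
      · exact Filter.mem_of_superset ((isOpen_lt f.continuous continuous_const).mem_nhds hac)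
          fun z (hz : f z < c) => hz.le
      · have h1 : closedConvexHull ℝ ({z | f z ≤ c} ∩ closure A) ⊆ {z | f z ≤ c} :=
          closedConvexHull_min Set.inter_subset_left
            (convex_halfSpace_le f.toLinearMap.isLinear c)
            (isClosed_le f.continuous continuous_const)
        exact absurd (h1 h) (not_le.2 hcx)
  rw [Set.inter_self] at key
  exact key (closedConvexHull_closure_eq_closedConvexHull (𝕜 := ℝ) (s := A) ▸ hx.1)

end Milman

namespace C0Subspace

open StrongDual WeakDual

variable {Y : Type*} [TopologicalSpace Y] (E : Submodule ℝ C₀(Y, ℝ))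

/-- The functionals `f ↦ f y` and `f ↦ -f y` on `E`, in the weak-* dual. -/
def signedEvals : Set (WeakDual ℝ E) :=
  {φ | ∃ y, φ = toWeakDual (pointEval E y) ∨ φ = -toWeakDual (pointEval E y)}

theorem norm_pointEval_le (y : Y) : ‖pointEval E y‖ ≤ 1 :=
  LinearMap.mkContinuous_norm_le _ zero_le_one _

instance : LocallyConvexSpace ℝ (WeakDual ℝ E) :=
  inferInstanceAs (LocallyConvexSpace ℝ (WeakBilin (topDualPairing ℝ E)))

/-- By Hahn–Banach, the dual unit ball is the weak-* closed convex hull of the signed evaluations.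
For empty `Y` there are no evaluations and the hull is empty. -/
theorem closedConvexHull_signedEvals [Nonempty Y] :
    closedConvexHull ℝ (signedEvals E) = toStrongDual ⁻¹' Metric.closedBall 0 1 := by
  apply Set.Subset.antisymm
  · refine closedConvexHull_min ?_ ?_ (WeakDual.isClosed_closedBall 0 1)
    · rintro φ ⟨y, rfl | rfl⟩
      · simpa using norm_pointEval_le E y
      · simpa using norm_pointEval_le E y
    · exact (convex_closedBall (0 : StrongDual ℝ E) 1).linear_preimage
        (toStrongDual (𝕜 := ℝ) (E := E)).toLinearMap
  · intro φ hφ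
    by_contra hφA
    obtain ⟨g, c, hg, hgφ⟩ := geometric_hahn_banach_closed_point
      (convex_closedConvexHull (𝕜 := ℝ) (s := signedEvals E)) isClosed_closedConvexHull hφA
    obtain ⟨e, he⟩ : ∃ e : E, ∀ ψ : WeakDual ℝ E, g ψ = ψ e := by
      obtain ⟨e, he⟩ := LinearMap.dualEmbedding_surjective (topDualPairing ℝ E) g
      exact ⟨e, fun ψ => by rw [← he]; rfl⟩
    have hev : ∀ y, |(e : C₀(Y, ℝ)) y| ≤ c := fun y => by
      have h1 := hg _ (subset_closedConvexHull ⟨y, Or.inl rfl⟩)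
      have h2 := hg _ (subset_closedConvexHull ⟨y, Or.inr rfl⟩)
      rw [map_neg] at h2
      rw [he] at h1 h2
      have h3 : toWeakDual (pointEval E y) e = (e : C₀(Y, ℝ)) y := rfl
      rw [h3] at h1 h2
      exact abs_le.2 ⟨by linarith, h1.le⟩
    have hc : 0 ≤ c := (abs_nonneg _).trans (hev (Classical.arbitrary Y))
    have h4 : ‖e‖ ≤ c := norm_le_of_forall hc hev
    have h5 : φ e ≤ ‖e‖ := by
      have h6 := (toStrongDual φ).le_opNorm e
      have h7 : ‖toStrongDual φ‖ ≤ 1 := by simpa using hφ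
      exact (le_abs_self _).trans (h6.trans (mul_le_of_le_one_left (norm_nonneg e) h7))
    rw [he] at hgφ
    linarith

theorem continuous_toWeakDual_pointEval :
    Continuous fun y => (toWeakDual (pointEval E y) : WeakDual ℝ E) :=
  WeakBilin.continuous_of_continuous_eval _ fun f => map_continuous (f : C₀(Y, ℝ))

theorem isCompact_le_abs (f : C₀(Y, ℝ)) {c : ℝ} (hc : 0 < c) : IsCompact {y | c ≤ |f y|} := by
  have h : {y | |f y| < c} ∈ Filter.cocompact Y := by
    have h1 : Filter.Tendsto (fun y => |f y|) (Filter.cocompact Y) (nhds |0|) :=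
      f.zero_at_infty'.abs
    rw [abs_zero] at h1
    exact h1.eventually (gt_mem_nhds hc)
  obtain ⟨t, ht, hts⟩ := Filter.mem_cocompact.1 h
  refine ht.of_isClosed_subset (isClosed_le continuous_const (map_continuous f).abs) fun y hy => ?_
  by_contra hyt
  exact absurd (show |f y| < c from hts hyt) (not_lt.2 hy)

/-- A weak-* limit of signed evaluations that does not annihilate `f` is a signed evaluation,
since `f` vanishes at infinity. -/
theorem mem_signedEvals_of_mem_closure {φ : WeakDual ℝ E} (hφ : φ ∈ closure (signedEvals E))
    {f : E} (hf : φ f ≠ 0) : φ ∈ signedEvals E := by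
  set c : ℝ := |φ f| / 2 with hc
  have hc0 : 0 < c := half_pos (abs_pos.2 hf)
  set B : Set (WeakDual ℝ E) :=
    (fun y => toWeakDual (pointEval E y)) '' {y | c ≤ |(f : C₀(Y, ℝ)) y|} with hB
  have hBc : IsCompact B :=
    (isCompact_le_abs (f : C₀(Y, ℝ)) hc0).image (continuous_toWeakDual_pointEval E)
  have hsub : signedEvals E ⊆ (B ∪ -B) ∪ {ψ | |ψ f| ≤ c} := by
    rintro ψ ⟨y, hψ⟩
    by_cases hy : c ≤ |(f : C₀(Y, ℝ)) y|
    · left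
      rcases hψ with rfl | rfl
      · exact Or.inl ⟨y, hy, rfl⟩
      · exact Or.inr ⟨y, hy, (neg_neg _).symm⟩
    · right
      have h1 : toWeakDual (pointEval E y) f = (f : C₀(Y, ℝ)) y := rfl
      rcases hψ with rfl | rfl
      · exact (not_le.1 hy).le
      · have h2 : (-toWeakDual (pointEval E y)) f = -(f : C₀(Y, ℝ)) y := rfl
        rw [Set.mem_ofPred_eq, h2, abs_neg]
        exact (not_le.1 hy).le
  have hcl : IsClosed ((B ∪ -B) ∪ {ψ : WeakDual ℝ E | |ψ f| ≤ c}) :=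
    (hBc.isClosed.union hBc.neg.isClosed).union
      (isClosed_le (WeakDual.eval_continuous f).abs continuous_const)
  rcases closure_minimal hsub hcl hφ with (⟨y, -, rfl⟩ | ⟨y, -, hy⟩) | h
  · exact ⟨y, Or.inl rfl⟩
  · exact ⟨y, Or.inr (by rw [← neg_neg φ, ← hy])⟩
  · have h1 : |φ f| ≤ |φ f| / 2 := h
    linarith [abs_pos.2 hf]

theorem mem_choquetBoundary_of_extreme {y : Y} {φ : WeakDual ℝ E}
    (hφ : φ ∈ (toStrongDual ⁻¹' Metric.closedBall (0 : StrongDual ℝ E) 1).extremePoints ℝ)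
    (h : φ = toWeakDual (pointEval E y) ∨ φ = -toWeakDual (pointEval E y)) :
    y ∈ choquetBoundary E := by
  rw [mem_extremePoints] at hφ
  refine mem_extremePoints.2 ⟨by simpa using norm_pointEval_le E y, ?_⟩
  rintro a ha b hb ⟨s, t, hs, ht, hst, hab⟩
  rw [mem_closedBall_zero_iff] at ha hb
  rcases h with rfl | rfl
  · have h := hφ.2 (toWeakDual a) (by simpa using ha) (toWeakDual b) (by simpa using hb)
      ⟨s, t, hs, ht, hst, by rw [← map_smul, ← map_smul, ← map_add, hab]⟩
    exact ⟨toWeakDual.injective h.1, toWeakDual.injective h.2⟩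
  · have h := hφ.2 (-toWeakDual a) (by simpa using ha) (-toWeakDual b) (by simpa using hb)
      ⟨s, t, hs, ht, hst, by
        rw [smul_neg, smul_neg, ← neg_add, ← map_smul, ← map_smul, ← map_add, hab]⟩
    exact ⟨toWeakDual.injective (neg_injective h.1), toWeakDual.injective (neg_injective h.2)⟩

/-- Every unit vector of `E` attains its norm on the Choquet boundary: the functionals of the dual
ball taking the value `1` at `f` form a weak-* compact face, which has an extreme point. -/
theorem exists_mem_choquetBoundary {f : E} (hf : ‖f‖ = 1) :
    ∃ y ∈ choquetBoundary E, |(f : C₀(Y, ℝ)) y| = 1 := by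
  have hY : Nonempty Y := by
    by_contra hY
    rw [not_nonempty_iff] at hY
    have h : ‖(f : C₀(Y, ℝ))‖ ≤ 0 := norm_le_of_forall le_rfl fun z => hY.elim z
    have h' : ‖(f : C₀(Y, ℝ))‖ = 1 := hf
    linarith
  set K : Set (WeakDual ℝ E) := toStrongDual ⁻¹' Metric.closedBall 0 1 with hK
  have hKc : IsCompact K := WeakDual.isCompact_closedBall 0 1
  have hKle : ∀ φ ∈ K, φ f ≤ 1 := by
    intro φ hφ
    have h6 := (toStrongDual φ).le_opNorm f
    have h7 : ‖toStrongDual φ‖ ≤ 1 := by simpa [hK] using hφ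
    rw [hf, mul_one] at h6
    exact (le_abs_self _).trans (h6.trans h7)
  have hne : (K ∩ {φ | φ f = 1}).Nonempty := by
    obtain ⟨g, hg, hgf⟩ := exists_dual_vector'' ℝ f
    exact ⟨toWeakDual g, by simpa [hK] using hg, by simpa [hf] using hgf⟩
  have hcomp : IsCompact (K ∩ {φ | φ f = 1}) :=
    hKc.inter_right (isClosed_eq (WeakDual.eval_continuous f) continuous_const)
  have hext : IsExtreme ℝ K (K ∩ {φ | φ f = 1}) := by
    refine ⟨Set.inter_subset_left, ?_⟩
    rintro a ha b hb _ ⟨-, hx⟩ ⟨s, t, hs, ht, hst, rfl⟩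
    refine ⟨ha, ?_⟩
    have h1 : s * a f + t * b f = 1 := hx
    have h2 := hKle a ha
    have h3 := mul_le_mul_of_nonneg_left (hKle b hb) ht.le
    have h4 : s * 1 ≤ s * a f := by linarith
    exact le_antisymm h2 (le_of_mul_le_mul_left h4 hs)
  obtain ⟨φ, hφ⟩ := hcomp.extremePoints_nonempty hne
  have hφK := hext.extremePoints_subset_extremePoints hφ
  have hφf : φ f = 1 := hφ.1.2
  have hφA : φ ∈ closure (signedEvals E) := by
    apply mem_closure_of_mem_extremePoints_closedConvexHull <;>
      rw [closedConvexHull_signedEvals]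
    exacts [hKc, hφK]
  obtain ⟨y, hy⟩ := mem_signedEvals_of_mem_closure E hφA (f := f) (by simp [hφf])
  refine ⟨y, mem_choquetBoundary_of_extreme E hφK hy, ?_⟩
  rcases hy with rfl | rfl
  · have h : (f : C₀(Y, ℝ)) y = 1 := hφf
    rw [h, abs_one]
  · have h : -(f : C₀(Y, ℝ)) y = 1 := hφf
    rw [← abs_neg, h, abs_one]

end C0Subspace

/-! ### The Mazur–Ulam property -/

namespace C0Subspace

variable {Y : Type*} [TopologicalSpace Y]

/-- The isometry is transported along the evaluations at the points of the Choquet boundary. -/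
theorem mazurUlamProperty_of_peaksAt {Y : Type u} [TopologicalSpace Y]
    {E : Submodule ℝ C₀(Y, ℝ)} (hcl : IsClosed (E : Set C₀(Y, ℝ)))
    (hE : ∀ y ∈ choquetBoundary E, PeaksAt E y) : MazurUlamProperty.{u, v} E := by
  refine mazurUlamProperty_of_functionals (pointEval E '' choquetBoundary E) ?_ ?_ ?_
  · rintro _ ⟨y, -, rfl⟩ f
    exact (le_abs_self _).trans (abs_apply_le_norm (f : C₀(Y, ℝ)) y)
  · intro f hf
    obtain ⟨y, hy, hfy⟩ := exists_mem_choquetBoundary E hf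
    exact ⟨_, ⟨y, hy, rfl⟩, hfy⟩
  · rintro _ ⟨y, hy, rfl⟩ f hf ε hε
    obtain ⟨g, hgE, hg1, hgy, hgf⟩ := (hE y hy).exists_near_face hcl f.2 hf.le hε
    exact ⟨⟨g, hgE⟩, hg1, hgy, hgf⟩

theorem peaksAt_top [LocallyCompactSpace Y] [T2Space Y] (y : Y) :
    PeaksAt (⊤ : Submodule ℝ C₀(Y, ℝ)) y := by
  intro V hV ε hε
  obtain ⟨f, hfy, hfV, hfc, hf⟩ := exists_continuous_one_zero_of_isCompact
    (isCompact_singleton (x := y)) (isOpen_interior (s := V)).isClosed_compl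
    (by simpa using mem_interior_iff_mem_nhds.2 hV)
  refine ⟨⟨f, hfc.is_zero_at_infty⟩, Submodule.mem_top, hf, hfy rfl, fun z hz => ?_⟩
  have h : f z = 0 := hfV fun hz' => hz (interior_subset hz')
  exact h.trans_le hε.le

end C0Subspace

theorem MazurUlamProperty.of_linearIsometryEquiv {E E' : Type u} [NormedAddCommGroup E]
    [NormedSpace ℝ E] [NormedAddCommGroup E'] [NormedSpace ℝ E'] (e : E ≃ₗᵢ[ℝ] E')
    (h : MazurUlamProperty.{u, v} E) : MazurUlamProperty.{u, v} E' := by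
  intro F _ _ _ T hT hs
  let S : Metric.sphere (0 : E) 1 → Metric.sphere (0 : E') 1 := fun a => ⟨e a, by simp⟩
  have hS : Isometry S := Isometry.of_dist_eq fun a b => e.dist_map a b
  have hSs : Function.Surjective S := fun b =>
    ⟨⟨e.symm b, by simp⟩, Subtype.ext (e.apply_symm_apply b)⟩
  obtain ⟨L, hL⟩ := h F (T ∘ S) (hT.comp hS) (hs.comp hSs)
  refine ⟨e.symm.trans L, fun b => ?_⟩
  obtain ⟨a, rfl⟩ := hSs b
  rw [← Function.comp_apply (f := T), ← hL a]
  simp [S]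

theorem corollary5p3 {Y : Type u} [TopologicalSpace Y] [LocallyCompactSpace Y] [T2Space Y] :
    (∀ E : Submodule ℝ C₀(Y, ℝ), IsClosed (E : Set C₀(Y, ℝ)) →
      C0Subspace.SeparatesPoints E → C0Subspace.ConditionR E → MazurUlamProperty.{u, v} E) ∧
    MazurUlamProperty.{u, v} C₀(Y, ℝ) := by
  refine ⟨fun E hcl _ hE => C0Subspace.mazurUlamProperty_of_peaksAt hcl hE, ?_⟩
  refine MazurUlamProperty.of_linearIsometryEquiv (LinearIsometryEquiv.ofTop _ ⊤ rfl)
    (C0Subspace.mazurUlamProperty_of_peaksAt isClosed_univ fun y _ => ?_)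
  exact C0Subspace.peaksAt_top y
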